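/- Let $p$ be a prime and let $U$ be a uniform pro-$p$ group, that is, a pro-$p$ group $U$ such that: (i) $U$ is topologically finitely generated; (ii) $U$ is powerful, i.e. $U/\overline{U^p}$ is abelian if $p$ is odd, and $U/\overline{U^4}$ is abelian if $p=2$, where $U^n$ denotes the subgroup generated by all $n$-th powers; (iii) $|P_i(U):P_{i+1}(U)| = |U:P_2(U)|$ for all $i\ge 1$, where $P_1(U)=U$ and $P_{i+1}(U)=\overline{P_i(U)^p[P_i(U),U]}$. Let $c$ be a nonnegative integer and let $G$ be a (not necessarily closed) subgroup of $U$ that has a subgroup of finite index which is nilpotent of class at most $c$. Then $G$ is nilpotent of class at most $c$. -/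

import Mathlib

namespace ProPGroup

/-- A pro-`p` group: a profinite group in which every open normal subgroup has index a power
of `p`. -/
structure IsProP (p : ℕ) (U : Type*) [Group U] [TopologicalSpace U] [IsTopologicalGroup U] :
    Prop where
  compactSpace : CompactSpace U
  t2Space : T2Space U
  totallyDisconnectedSpace : TotallyDisconnectedSpace U
  index_eq_pow : ∀ N : Subgroup U, N.Normal → IsOpen (N : Set U) → ∃ k : ℕ, N.index = p ^ k

/-- Topological finite generation: some finite set generates a dense subgroup. -/
def IsTopologicallyFG (U : Type*) [Group U] [TopologicalSpace U] : Prop :=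
  ∃ S : Finset U, Dense (Subgroup.closure (S : Set U) : Set U)

/-- The subgroup `Hⁿ` generated by the `n`-th powers of the elements of `H`. -/
def powerSubgroup {U : Type*} [Group U] (H : Subgroup U) (n : ℕ) : Subgroup U :=
  Subgroup.closure ((fun x : U => x ^ n) '' (H : Set U))

/-- Powerful: `U` modulo the closure of `U ^ p` (of `U ^ 4` if `p = 2`) is abelian, i.e. that
closure contains the commutator subgroup. -/
def IsPowerful (p : ℕ) (U : Type*) [Group U] [TopologicalSpace U] [IsTopologicalGroup U] : Prop :=
  commutator U ≤ (powerSubgroup (⊤ : Subgroup U) (if p = 2 then 4 else p)).topologicalClosure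

/-- The lower `p`-series, indexed from `0`: it starts at `U`, and the term after `P` is the
closure of `Pᵖ[P, U]`. -/
def lowerPSeries (p : ℕ) (U : Type*) [Group U] [TopologicalSpace U] [IsTopologicalGroup U] :
    ℕ → Subgroup U
  | 0 => ⊤
  | i + 1 =>
    (powerSubgroup (lowerPSeries p U i) p ⊔ ⁅lowerPSeries p U i, (⊤ : Subgroup U)⁆).topologicalClosure

/-- A uniform (uniformly powerful) pro-`p` group: topologically finitely generated, powerful,
and all successive factors of the lower `p`-series have the same order. -/
structure IsUniform (p : ℕ) (U : Type*) [Group U] [TopologicalSpace U] [IsTopologicalGroup U] :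
    Prop where
  isProP : IsProP p U
  isTopologicallyFG : IsTopologicallyFG U
  isPowerful : IsPowerful p U
  relIndex_eq : ∀ i : ℕ,
    (lowerPSeries p U (i + 1)).relIndex (lowerPSeries p U i) = (lowerPSeries p U 1).index

/-- `G` is nilpotent of class at most `c`. -/
def IsNilpotentOfClassLE (c : ℕ) (G : Type*) [Group G] : Prop :=
  Group.IsNilpotent G ∧ Group.nilpotencyClass G ≤ c

/-- Some subgroup of finite index in `G` is nilpotent of class at most `c`. -/
def IsVirtuallyNilpotentOfClassLE (c : ℕ) (G : Type*) [Group G] : Prop :=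
  ∃ N : Subgroup G, N.FiniteIndex ∧ IsNilpotentOfClassLE c N

end ProPGroup

open scoped commutatorElement

namespace ProPGroup

/-! ### Virtual nilpotency in groups with unique roots -/

section UniqueRoots

variable {G : Type*} [Group G] [IsMulTorsionFree G]

/-! A uniform group has unique roots, and subgroups inherit this. In a group with unique roots,
commuting with a nonzero power of `g` means commuting with `g`. So the centre of a finite-index
subgroup is central in the whole group. The quotient by the centre again has unique roots, and
induction on the class finishes.

For unique roots in `U`, prime exponents suffice, and the terms `P m` of the lower `p`-series meet
trivially, so one works modulo each `P m`. Exponents prime to `p` are harmless in a `p`-group. For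
exponent `p`, powering induces a map from `U ⧸ P m` to `P 1 ⧸ P (m + 1)`. Powerfulness makes it
surjective, uniformity makes both sides finite of equal size, so it is injective. -/

theorem commute_of_pow_left {x y : G} {n : ℕ} (hn : n ≠ 0) (h : Commute (x ^ n) y) :
    Commute x y := by
  have : y * x * y⁻¹ = x := by
    apply IsMulTorsionFree.pow_left_injective hn
    simp only [conj_pow]
    rw [← h.eq, mul_inv_cancel_right]
  exact (mul_inv_eq_iff_eq_mul.mp this).symm

theorem commute_of_pow_right {x y : G} {n : ℕ} (hn : n ≠ 0) (h : Commute x (y ^ n)) :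
    Commute x y :=
  (commute_of_pow_left hn h.symm).symm

theorem mem_center_of_pow_mem {x : G} {n : ℕ} (hn : n ≠ 0) (h : x ^ n ∈ Subgroup.center G) :
    x ∈ Subgroup.center G :=
  Subgroup.mem_center_iff.mpr fun g =>
    commute_of_pow_right hn (Subgroup.mem_center_iff.mp h g)

/-- If `x ^ n` and `y ^ n` agree modulo the centre, they commute, hence so do `x` and `y`. Then
`(x⁻¹ * y) ^ n` is central, and so is its root. -/
instance isMulTorsionFree_quotient_center : IsMulTorsionFree (G ⧸ Subgroup.center G) where
  pow_left_injective n hn := by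
    intro a b
    induction a using QuotientGroup.induction_on with | _ x
    induction b using QuotientGroup.induction_on with | _ y
    intro h
    replace h : (x ^ n)⁻¹ * y ^ n ∈ Subgroup.center G := QuotientGroup.eq.mp h
    have hxy : Commute x y := by
      refine commute_of_pow_left hn (commute_of_pow_right hn ?_)
      have hc : Commute (x ^ n) ((x ^ n)⁻¹ * y ^ n) := Subgroup.mem_center_iff.mp h _
      simpa using (Commute.refl (x ^ n)).mul_right hc
    refine QuotientGroup.eq.mpr (mem_center_of_pow_mem hn ?_)
    rwa [hxy.inv_left.mul_pow, inv_pow]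

theorem map_center_le_center {N : Subgroup G} (hN : N.index ≠ 0) :
    (Subgroup.center N).map N.subtype ≤ Subgroup.center G := by
  rintro _ ⟨z, hz, rfl⟩
  refine Subgroup.mem_center_iff.mpr fun g => ?_
  obtain ⟨n, hn, -, hgn⟩ := Subgroup.exists_pow_mem_of_index_ne_zero hN g
  refine commute_of_pow_left hn.ne' ?_
  exact congrArg Subtype.val (Subgroup.mem_center_iff.mp hz ⟨g ^ n, hgn⟩)

end UniqueRoots

/-- A group with unique roots that is virtually nilpotent of class at most `c` is nilpotent of
class at most `c`. -/
theorem isNilpotentOfClassLE_of_virtually (c : ℕ) : ∀ (G : Type*) [Group G] [IsMulTorsionFree G],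
    IsVirtuallyNilpotentOfClassLE c G → IsNilpotentOfClassLE c G := by
  induction c with
  | zero =>
    rintro G _ _ ⟨N, hN, hnil, hc⟩
    have : Subsingleton N := Group.nilpotencyClass_zero_iff_subsingleton.mp (Nat.le_zero.mp hc)
    have : Subsingleton G := by
      refine subsingleton_of_forall_eq 1 fun g => ?_
      obtain ⟨n, hn, -, hgn⟩ := Subgroup.exists_pow_mem_of_index_ne_zero hN.index_ne_zero g
      apply IsMulTorsionFree.pow_left_injective hn.ne'
      simpa using congrArg Subtype.val (Subsingleton.elim (⟨g ^ n, hgn⟩ : N) 1)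
    exact ⟨inferInstance, (Group.nilpotencyClass_zero_iff_subsingleton.mpr this).le⟩
  | succ c ih =>
    rintro G _ _ ⟨N, hN, hnil, hc⟩
    let π := QuotientGroup.mk' (Subgroup.center G)
    -- The image of `N` modulo the centre of `G` is a quotient of `N ⧸ Subgroup.center N`, so its
    -- class drops by one.
    have hle : Subgroup.center N ≤ (π.subgroupMap N).ker := by
      intro z hz
      have : (z : G) ∈ Subgroup.center G :=
        map_center_le_center hN.index_ne_zero ⟨z, hz, rfl⟩
      exact Subtype.ext ((QuotientGroup.eq_one_iff _).mpr this)
    let φ : N ⧸ Subgroup.center N →* N.map π := QuotientGroup.lift _ (π.subgroupMap N) hle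
    have hφ : Function.Surjective φ :=
      QuotientGroup.lift_surjective_of_surjective _ _ (π.subgroupMap_surjective N) hle
    have hfin : (N.map π).FiniteIndex :=
      ⟨fun h0 => hN.index_ne_zero (Nat.eq_zero_of_zero_dvd
        (h0 ▸ N.index_map_dvd (QuotientGroup.mk'_surjective _)))⟩
    have hclass : IsNilpotentOfClassLE c (N.map π) := by
      refine ⟨Group.nilpotent_of_surjective φ hφ,
        (Group.nilpotencyClass_le_of_surjective φ hφ).trans ?_⟩
      rw [Group.nilpotencyClass_quotient_center]
      omega
    obtain ⟨hq, hqc⟩ := ih (G ⧸ Subgroup.center G) ⟨N.map π, hfin, hclass⟩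
    refine ⟨Group.of_quotient_center_nilpotent hq, ?_⟩
    rw [Group.nilpotencyClass_quotient_center] at hqc
    omega

/-! ### Powers of products in class two -/

section Collection

variable {G : Type*} [Group G]

theorem pow_mul_eq_of_mul_eq {x a k : G} (h : a * x = x * a * k) (ha : Commute k a)
    (n : ℕ) : a ^ n * x = x * a ^ n * k ^ n := by
  induction n with
  | zero => simp
  | succ n ih =>
    calc a ^ (n + 1) * x = a ^ n * (a * x) := by rw [pow_succ, mul_assoc]
      _ = (a ^ n * x) * (a * k) := by rw [h]; group
      _ = x * a ^ n * (k ^ n * a) * k := by rw [ih]; group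
      _ = x * a ^ n * (a * k ^ n) * k := by rw [(ha.pow_left n).eq]
      _ = x * a ^ (n + 1) * k ^ (n + 1) := by simp only [pow_succ, mul_assoc]

/-- The collection formula in class two. -/
theorem mul_pow_eq_of_mul_eq {x a k : G} (h : a * x = x * a * k) (hx : Commute k x)
    (ha : Commute k a) (n : ℕ) : (x * a) ^ n = x ^ n * a ^ n * k ^ n.choose 2 := by
  induction n with
  | zero => simp
  | succ n ih =>
    have hc : Commute (k ^ n.choose 2) (x * a) := (hx.mul_right ha).pow_left _
    calc (x * a) ^ (n + 1) = x ^ n * a ^ n * (k ^ n.choose 2 * (x * a)) := by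
          rw [pow_succ, ih, mul_assoc]
      _ = x ^ n * (a ^ n * x) * a * k ^ n.choose 2 := by rw [hc.eq]; simp only [mul_assoc]
      _ = x ^ n * x * a ^ n * (k ^ n * a) * k ^ n.choose 2 := by
          rw [pow_mul_eq_of_mul_eq h ha]; simp only [mul_assoc]
      _ = x ^ n * x * (a ^ n * a) * (k ^ n * k ^ n.choose 2) := by
          rw [(ha.pow_left n).eq]; simp only [mul_assoc]
      _ = x ^ (n + 1) * a ^ (n + 1) * k ^ (n + 1).choose 2 := by
          rw [← pow_succ, ← pow_succ, ← pow_add, Nat.choose_succ_succ' n 1, Nat.choose_one_right]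

/-- The correction term is `k ^ p.choose 2`. An odd `p` divides this exponent; for `p = 2` the
exponent is `1`, hence the extra hypothesis. -/
theorem mul_pow_prime_eq {p : ℕ} (hp : p.Prime) {x a k : G} (h : a * x = x * a * k)
    (hx : Commute k x) (ha : Commute k a) (hk : k ^ p = 1) (h2 : p = 2 → k = 1) :
    (x * a) ^ p = x ^ p * a ^ p := by
  rw [mul_pow_eq_of_mul_eq h hx ha]
  rcases hp.eq_two_or_odd' with h' | h'
  · simp [h2 h']
  · obtain ⟨d, hd⟩ : p ∣ p.choose 2 := hp.dvd_choose_self two_ne_zero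
      (lt_of_le_of_ne hp.two_le fun h => by subst h; exact absurd h' (by decide))
    rw [hd, pow_mul, hk, one_pow, mul_one]

theorem powerSubgroup_normal (H : Subgroup G) [hH : H.Normal] (n : ℕ) :
    (powerSubgroup H n).Normal := by
  refine ⟨fun x hx g => ?_⟩
  induction hx using Subgroup.closure_induction with
  | mem x hx =>
    obtain ⟨y, hy, rfl⟩ := hx
    exact Subgroup.subset_closure ⟨g * y * g⁻¹, hH.conj_mem y hy g, conj_pow⟩
  | one => simp
  | mul x y _ _ hx hy => simpa using mul_mem hx hy
  | inv x _ hx => simpa [mul_assoc] using inv_mem hx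

theorem pow_mem_powerSubgroup {H : Subgroup G} {n : ℕ} {x : G} (hx : x ∈ H) :
    x ^ n ∈ powerSubgroup H n :=
  Subgroup.subset_closure ⟨x, hx, rfl⟩

end Collection

/-! ### Powers and commutators along the lower `p`-series -/

section LowerPSeries

variable {p : ℕ} {U : Type*} [Group U] [TopologicalSpace U] [IsTopologicalGroup U]

local notation "P" => lowerPSeries p U

instance lowerPSeries_normal (i : ℕ) : (P i).Normal := by
  induction i with
  | zero => exact Subgroup.normal_of_characteristic ⊤
  | succ i ih =>
    have := powerSubgroup_normal (P i) p
    exact Subgroup.is_normal_topologicalClosure _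

theorem isClosed_lowerPSeries (i : ℕ) : IsClosed (P i : Set U) := by
  cases i with
  | zero => exact isClosed_univ
  | succ i => exact Subgroup.isClosed_topologicalClosure _

theorem pow_mem_lowerPSeries_succ {i : ℕ} {a : U} (ha : a ∈ P i) : a ^ p ∈ P (i + 1) :=
  Subgroup.le_topologicalClosure _ (Subgroup.mem_sup_left (pow_mem_powerSubgroup ha))

theorem commutator_mem_lowerPSeries_succ {i : ℕ} {a : U} (ha : a ∈ P i) (g : U) :
    ⁅a, g⁆ ∈ P (i + 1) :=
  Subgroup.le_topologicalClosure _
    (Subgroup.mem_sup_right (Subgroup.commutator_mem_commutator ha (Subgroup.mem_top g)))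

theorem lowerPSeries_succ_le (i : ℕ) : P (i + 1) ≤ P i := by
  refine Subgroup.topologicalClosure_minimal _ (sup_le ?_ ?_) (isClosed_lowerPSeries i)
  · refine (Subgroup.closure_le _).mpr ?_
    rintro _ ⟨a, ha, rfl⟩
    exact pow_mem ha p
  · exact Subgroup.commutator_le_left _ _

theorem lowerPSeries_antitone : Antitone (lowerPSeries p U) :=
  antitone_nat_of_succ_le lowerPSeries_succ_le

theorem commute_mk_of_mem {i : ℕ} {a : U} (ha : a ∈ P i) (g : U ⧸ P (i + 1)) :
    Commute (a : U ⧸ P (i + 1)) g := by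
  induction g using QuotientGroup.induction_on with | _ g
  rw [← commutatorElement_eq_one_iff_commute]
  exact (QuotientGroup.eq_one_iff _).mpr (commutator_mem_lowerPSeries_succ ha g)

theorem mk_pow_eq_one_of_mem {i : ℕ} {a : U} (ha : a ∈ P i) :
    (a : U ⧸ P (i + 1)) ^ p = 1 :=
  (QuotientGroup.eq_one_iff _).mpr (pow_mem_lowerPSeries_succ ha)

/-- Taking `p`-th powers is well defined from `U ⧸ P i` to `U ⧸ P (i + 1)`. -/
theorem inv_pow_mul_pow_mem {i : ℕ} {x y : U} (h : x⁻¹ * y ∈ P i) :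
    (x ^ p)⁻¹ * y ^ p ∈ P (i + 1) := by
  rw [← QuotientGroup.eq]
  obtain ⟨a, rfl⟩ : ∃ a, y = x * a := ⟨x⁻¹ * y, by simp⟩
  rw [inv_mul_cancel_left] at h
  simp only [QuotientGroup.mk_pow, QuotientGroup.mk_mul]
  rw [(commute_mk_of_mem h _).symm.mul_pow, mk_pow_eq_one_of_mem h, mul_one]

/-- If `a ∈ P i` then `(x * a) ^ p` and `x ^ p * a ^ p` agree modulo `P (i + 2)`. -/
theorem mk_mul_pow (hp : p.Prime) {i : ℕ} {a : U} (x : U) (ha : a ∈ P i)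
    (h2 : p = 2 → ∀ g, ⁅a, g⁆ ∈ P (i + 2)) :
    ((x * a : U) : U ⧸ P (i + 2)) ^ p = (x : U ⧸ P (i + 2)) ^ p * (a : U ⧸ P (i + 2)) ^ p := by
  have hk : a⁻¹ * x⁻¹ * a * x ∈ P (i + 1) := by
    have := commutator_mem_lowerPSeries_succ (inv_mem ha) x⁻¹
    simpa [commutatorElement_def] using this
  refine mul_pow_prime_eq hp (G := U ⧸ P (i + 2)) (x := (x : U ⧸ P (i + 2)))
    (a := (a : U ⧸ P (i + 2))) (k := ((a⁻¹ * x⁻¹ * a * x : U) : U ⧸ P (i + 2))) ?_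
    (commute_mk_of_mem hk _) (commute_mk_of_mem hk _) (mk_pow_eq_one_of_mem hk) ?_
  · simp only [← QuotientGroup.mk_mul]
    congr 1
    group
  · intro h
    have hc : Commute (a : U ⧸ P (i + 2)) (x : U ⧸ P (i + 2)) := by
      rw [← commutatorElement_eq_one_iff_commute]
      exact (QuotientGroup.eq_one_iff _).mpr (h2 h x)
    simp only [QuotientGroup.mk_mul, QuotientGroup.mk_inv]
    rw [mul_assoc, hc.eq]
    group

/-- Since `a⁻¹ * ⁅a, g⁆` is the conjugate of `a⁻¹` by `g`, its `p`-th power is `(a ^ p)⁻¹ * ⁅a ^ p,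
g⁆`; expand that power by `mk_mul_pow`. -/
theorem mk_commutator_pow (hp : p.Prime) {i : ℕ} {a : U} (g : U) (ha : a ∈ P i)
    (h2 : p = 2 → ∀ h, ⁅⁅a, g⁆, h⁆ ∈ P (i + 3)) :
    ((⁅a ^ p, g⁆ : U) : U ⧸ P (i + 3)) = ((⁅a, g⁆ : U) : U ⧸ P (i + 3)) ^ p := by
  have h := mk_mul_pow hp a⁻¹ (commutator_mem_lowerPSeries_succ ha g) h2
  have hconj : a⁻¹ * ⁅a, g⁆ = g * a⁻¹ * g⁻¹ := by rw [commutatorElement_def]; group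
  have hpow : a ^ p * (a⁻¹ * ⁅a, g⁆) ^ p = ⁅a ^ p, g⁆ := by
    rw [hconj, conj_pow, commutatorElement_def, inv_pow]; group
  rw [← hpow, QuotientGroup.mk_mul, QuotientGroup.mk_pow _ (a⁻¹ * _), h]
  simp

/-- Open subgroups are closed. Modulo an open term, closures may thus be ignored and generators
checked instead. -/
theorem topologicalClosure_le_sup {N : Subgroup U} (H : Subgroup U) (hN : IsOpen (N : Set U)) :
    H.topologicalClosure ≤ H ⊔ N :=
  H.topologicalClosure_minimal le_sup_left
    (Subgroup.isClosed_of_isOpen _ (Subgroup.isOpen_mono le_sup_right hN))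

theorem lowerPSeries_succ_le_sup (hopen : ∀ i, IsOpen (P i : Set U)) (i : ℕ) :
    P (i + 1) ≤ powerSubgroup (P i) p ⊔ ⁅P i, (⊤ : Subgroup U)⁆ ⊔ P (i + 2) :=
  topologicalClosure_le_sup _ (hopen _)

/-- In a powerful pro-`2` group, `[P i, U] ≤ P (i + 2)`. -/
theorem commutator_mem_lowerPSeries_add_two (hopen : ∀ i, IsOpen (P i : Set U))
    (hpow : IsPowerful p U) (h2 : p = 2) (i : ℕ) :
    ∀ a ∈ P i, ∀ g, ⁅a, g⁆ ∈ P (i + 2) := by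
  have hp : p.Prime := h2 ▸ Nat.prime_two
  induction i with
  | zero =>
    intro a _ g
    have hle : powerSubgroup (⊤ : Subgroup U) (if p = 2 then 4 else p) ≤ P 2 := by
      refine (Subgroup.closure_le _).mpr ?_
      rintro _ ⟨x, -, rfl⟩
      have : (x ^ p) ^ p ∈ P 2 :=
        pow_mem_lowerPSeries_succ (pow_mem_lowerPSeries_succ (i := 0) (Subgroup.mem_top x))
      simpa [h2, ← pow_mul] using this
    exact Subgroup.topologicalClosure_minimal _ hle (isClosed_lowerPSeries 2)
      (hpow (Subgroup.commutator_mem_commutator (Subgroup.mem_top a) (Subgroup.mem_top g)))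
  | succ i ih =>
    -- The elements central modulo `P (i + 3)` form a subgroup, so only generators of `P (i + 1)`
    -- need testing.
    let C : Subgroup U := (Subgroup.center (U ⧸ P (i + 3))).comap (QuotientGroup.mk' _)
    have hC : ∀ b : U, b ∈ C ↔ ∀ g, ⁅b, g⁆ ∈ P (i + 3) := by
      intro b
      have hb : b ∈ C ↔ ∀ q : U ⧸ P (i + 3), q * b = b * q := Subgroup.mem_center_iff
      rw [hb, QuotientGroup.mk_surjective.forall]
      refine forall_congr' fun g => ?_
      rw [← QuotientGroup.eq_one_iff, eq_comm]
      exact (commutatorElement_eq_one_iff_mul_comm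
        (g₁ := (b : U ⧸ P (i + 3))) (g₂ := (g : U ⧸ P (i + 3)))).symm
    have hdeep : P (i + 2) ≤ C := fun b hb =>
      (hC b).mpr fun g => commutator_mem_lowerPSeries_succ hb g
    have hle : P (i + 1) ≤ C := by
      refine (lowerPSeries_succ_le_sup hopen i).trans (sup_le (sup_le ?_ ?_) hdeep)
      · refine (Subgroup.closure_le _).mpr ?_
        rintro _ ⟨a, ha, rfl⟩
        refine (hC _).mpr fun g => ?_
        rw [← QuotientGroup.eq_one_iff]
        refine (mk_commutator_pow hp g ha
          fun _ h => commutator_mem_lowerPSeries_succ (ih a ha g) h).trans ?_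
        exact mk_pow_eq_one_of_mem (ih a ha g)
      · exact (Subgroup.commutator_le.mpr fun a ha g _ => ih a ha g).trans hdeep
    exact fun a ha => (hC a).mp (hle ha)

/-- In a powerful pro-`p` group, every element of `P (i + 1)` is modulo `P (i + 2)` the `p`-th
power of an element of `P i`. -/
theorem exists_mk_eq_pow (hopen : ∀ i, IsOpen (P i : Set U)) (hp : p.Prime)
    (hpow : IsPowerful p U) (i : ℕ) :
    ∀ b ∈ P (i + 1), ∃ a ∈ P i, (b : U ⧸ P (i + 2)) = (a : U ⧸ P (i + 2)) ^ p := by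
  have h2 := commutator_mem_lowerPSeries_add_two hopen hpow
  -- Powering is a homomorphism modulo `P (i + 2)`, so the elements that are `p`-th powers there
  -- form a subgroup `T i`, to be tested on generators.
  let φ (i : ℕ) : P i →* U ⧸ P (i + 2) :=
    { toFun := fun a => ((a : U) : U ⧸ P (i + 2)) ^ p
      map_one' := by simp
      map_mul' := fun x y => mk_mul_pow hp (x : U) y.2 fun h => h2 h i y y.2 }
  let T (i : ℕ) : Subgroup U := (φ i).range.comap (QuotientGroup.mk' _)
  have hT : ∀ i (b a : U), a ∈ P i → (b : U ⧸ P (i + 2)) = (a : U ⧸ P (i + 2)) ^ p → b ∈ T i :=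
    fun i b a ha h => ⟨⟨a, ha⟩, h.symm⟩
  have hdeep : ∀ i, P (i + 2) ≤ T i := fun i b hb =>
    hT i b 1 (one_mem _) (by simpa using hb)
  have hle : ∀ i, ⁅P i, (⊤ : Subgroup U)⁆ ≤ T i → P (i + 1) ≤ T i := by
    intro i hi
    refine (lowerPSeries_succ_le_sup hopen i).trans (sup_le (sup_le ?_ hi) (hdeep i))
    refine (Subgroup.closure_le _).mpr ?_
    rintro _ ⟨a, ha, rfl⟩
    exact hT i _ a ha rfl
  suffices h : ∀ i, P (i + 1) ≤ T i by
    intro b hb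
    obtain ⟨⟨a, ha⟩, h⟩ := h i hb
    exact ⟨a, ha, h.symm⟩
  intro i
  induction i with
  | zero =>
    refine hle 0 (hpow.trans ((topologicalClosure_le_sup _ (hopen 2)).trans
      (sup_le ((Subgroup.closure_le _).mpr ?_) (hdeep 0))))
    rintro _ ⟨a, -, rfl⟩
    split_ifs with h
    -- For `p = 2` the generators are fourth powers, that is, squares of squares.
    · refine hT 0 _ (a ^ 2) (Subgroup.mem_top _) ?_
      rw [← QuotientGroup.mk_pow, ← pow_mul, h]
    · exact hT 0 _ a (Subgroup.mem_top _) rfl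
  | succ i ih =>
    refine hle (i + 1) (Subgroup.commutator_le.mpr fun b hb g _ => ?_)
    obtain ⟨⟨a, ha⟩, h⟩ := ih hb
    refine hT (i + 1) _ ⁅a, g⁆ (commutator_mem_lowerPSeries_succ ha g) ?_
    refine Eq.trans ?_ (mk_commutator_pow hp g ha fun h =>
      h2 h (i + 1) _ (commutator_mem_lowerPSeries_succ ha g))
    -- The factor `w` is central modulo `P (i + 3)`, so it drops out of the commutator with `g`.
    obtain ⟨w, hw, rfl⟩ : ∃ w ∈ P (i + 2), b = a ^ p * w :=
      ⟨(a ^ p)⁻¹ * b, QuotientGroup.eq.mp h, by simp⟩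
    have hc := commute_mk_of_mem hw (g : U ⧸ P (i + 3))
    change ⁅((a ^ p : U) : U ⧸ P (i + 3)) * (w : U ⧸ P (i + 3)), (g : U ⧸ P (i + 3))⁆ =
      ⁅((a ^ p : U) : U ⧸ P (i + 3)), (g : U ⧸ P (i + 3))⁆
    simp only [commutatorElement_def, mul_inv_rev]
    rw [mul_assoc _ (w : U ⧸ P (i + 3)), hc.eq]
    group

/-- Elements of `P 1` are `p`-th powers modulo every `P (m + 1)`. -/
theorem exists_pow_inv_mul_mem (hopen : ∀ i, IsOpen (P i : Set U)) (hp : p.Prime)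
    (hpow : IsPowerful p U) (m : ℕ) {z : U} (hz : z ∈ P 1) : ∃ x : U, (x ^ p)⁻¹ * z ∈ P (m + 1) := by
  induction m with
  | zero => exact ⟨1, by simpa using hz⟩
  | succ m ih =>
    obtain ⟨x, hx⟩ := ih
    obtain ⟨a, ha, h⟩ := exists_mk_eq_pow hopen hp hpow m _ hx
    -- The approximate root is corrected by a root `a` of the error.
    refine ⟨x * a, QuotientGroup.eq.mp ?_⟩
    rw [QuotientGroup.mk_pow, mk_mul_pow hp x ha fun h2 =>
      commutator_mem_lowerPSeries_add_two hopen hpow h2 m a ha, ← h]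
    simp

end LowerPSeries

/-! ### Finite index of `P 1` and trivial intersection of the series -/

section ProP

variable {p : ℕ} {U : Type*} [Group U] [TopologicalSpace U] [IsTopologicalGroup U]

local notation "P" => lowerPSeries p U

/-- The quotient is abelian of exponent `p`, so the image `K` of a dense finitely generated subgroup
is finite. Its preimage is a finite union of closed cosets, hence closed and dense, hence
everything. -/
theorem index_lowerPSeries_one_ne_zero (hp : p ≠ 0) (hfg : IsTopologicallyFG U) :
    (P 1).index ≠ 0 := by
  obtain ⟨S, hS⟩ := hfg
  let _ : CommGroup (U ⧸ P 1) :=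
    { (inferInstance : Group (U ⧸ P 1)) with
      mul_comm := fun x y => by
        induction x using QuotientGroup.induction_on with | _ x
        exact commute_mk_of_mem (i := 0) (Subgroup.mem_top x) y }
  let K : Subgroup (U ⧸ P 1) := (Subgroup.closure (S : Set U)).map (QuotientGroup.mk' (P 1))
  have hK : Finite K := by
    have hKfg : Group.FG K := by
      rw [Group.fg_iff_subgroup_fg, Subgroup.fg_iff]
      exact ⟨_, (MonoidHom.map_closure _ _).symm, S.finite_toSet.image _⟩
    refine CommGroup.finite_of_fg_isMulTorsion K fun x => ?_
    obtain ⟨⟨x⟩, hx⟩ := x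
    refine isOfFinOrder_iff_pow_eq_one.mpr ⟨p, Nat.pos_of_ne_zero hp, Subtype.ext ?_⟩
    exact mk_pow_eq_one_of_mem (i := 0) (Subgroup.mem_top x)
  have hclosed : IsClosed ((QuotientGroup.mk : U → U ⧸ P 1) ⁻¹' K) := by
    rw [← Set.biUnion_preimage_singleton]
    refine (Set.toFinite _).isClosed_biUnion fun q _ => ?_
    induction q using QuotientGroup.induction_on with | _ x
    have : (QuotientGroup.mk : U → U ⧸ P 1) ⁻¹' {(x : U ⧸ P 1)} =
        (fun y => x⁻¹ * y) ⁻¹' (P 1 : Set U) := by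
      ext y
      exact eq_comm.trans QuotientGroup.eq
    rw [this]
    exact (isClosed_lowerPSeries 1).preimage (continuous_const_mul x⁻¹)
  have htop : ∀ q : U ⧸ P 1, q ∈ K := by
    intro q
    induction q using QuotientGroup.induction_on with | _ x
    have : closure (Subgroup.closure (S : Set U) : Set U) ⊆ (QuotientGroup.mk : U → U ⧸ P 1) ⁻¹' K :=
      closure_minimal (fun y hy => ⟨y, hy, rfl⟩) hclosed
    exact this (hS x)
  have : Finite (U ⧸ P 1) := Finite.of_injective (fun q => (⟨q, htop q⟩ : K))
    fun _ _ h => congrArg Subtype.val h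
  exact Nat.card_pos.ne'

theorem isPGroup_quotient (hU : IsProP p U) {N : Subgroup U} [hN : N.Normal]
    (ho : IsOpen (N : Set U)) : IsPGroup p (U ⧸ N) := by
  obtain ⟨k, hk⟩ := hU.index_eq_pow N hN ho
  exact IsPGroup.of_card hk

/-- An open normal subgroup of index `p ^ k` contains the `k`-th term of the lower `p`-series. -/
theorem lowerPSeries_le_of_index_eq (hp : p.Prime) (k : ℕ) : ∀ N : Subgroup U, N.Normal →
    IsOpen (N : Set U) → N.index = p ^ k → P k ≤ N := by
  have := Fact.mk hp
  induction k with
  | zero =>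
    intro N _ _ hk
    exact (Subgroup.index_eq_one.mp hk).ge
  | succ k ih =>
    intro N hN ho hk
    have hcard : Nat.card (U ⧸ N) = p ^ (k + 1) := hk
    have hfin : Finite (U ⧸ N) :=
      Nat.finite_of_card_ne_zero (hcard ▸ pow_ne_zero _ hp.ne_zero)
    have hpg : IsPGroup p (U ⧸ N) := IsPGroup.of_card hcard
    have hnt : Nontrivial (U ⧸ N) :=
      Finite.one_lt_card_iff_nontrivial.mp (hcard ▸ Nat.one_lt_pow k.succ_ne_zero hp.one_lt)
    have := hpg.center_nontrivial
    obtain ⟨j, hj, hjc⟩ := (hpg.to_subgroup (Subgroup.center (U ⧸ N))).nontrivial_iff_card.mp this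
    obtain ⟨z, hz⟩ := exists_prime_orderOf_dvd_card' (G := Subgroup.center (U ⧸ N)) p
      (hjc ▸ dvd_pow_self p hj.ne')
    -- Induction applies to the preimage `M` of a central subgroup `Z` of order `p`: as `P k` maps
    -- into `Z`, its `p`-th powers and commutators die in `U ⧸ N`.
    let Z : Subgroup (U ⧸ N) := Subgroup.zpowers (z : U ⧸ N)
    have hZc : Z ≤ Subgroup.center (U ⧸ N) := Subgroup.zpowers_le.mpr z.2
    have hZp : ∀ y ∈ Z, y ^ p = 1 := by
      rintro _ ⟨n, rfl⟩
      have hzp : (z : U ⧸ N) ^ p = 1 := by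
        rw [← hz, ← Subgroup.orderOf_coe, pow_orderOf_eq_one]
      change ((z : U ⧸ N) ^ n) ^ p = 1
      rw [← zpow_natCast, zpow_comm, zpow_natCast, hzp, one_zpow]
    have hZn : Z.Normal := ⟨fun y hy g => by
      rw [Subgroup.mem_center_iff.mp (hZc hy) g, mul_inv_cancel_right]; exact hy⟩
    have hZcard : Nat.card Z = p := by
      rw [Nat.card_zpowers, Subgroup.orderOf_coe, hz]
    let M : Subgroup U := Z.comap (QuotientGroup.mk' N)
    have hNM : N ≤ M := fun x hx => by
      change (x : U ⧸ N) ∈ Z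
      rw [(QuotientGroup.eq_one_iff x).mpr hx]
      exact one_mem _
    have hMi : M.index = p ^ k := by
      have h1 : M.index = Z.index :=
        Subgroup.index_comap_of_surjective _ (QuotientGroup.mk'_surjective N)
      have h2 := Z.card_mul_index
      rw [hZcard, hcard, pow_succ'] at h2
      rw [h1]
      exact Nat.eq_of_mul_eq_mul_left hp.pos h2
    have hPM : P k ≤ M := ih M (hZn.comap _) (Subgroup.isOpen_mono hNM ho) hMi
    refine Subgroup.topologicalClosure_minimal _ (sup_le ?_ ?_) (Subgroup.isClosed_of_isOpen N ho)
    · refine (Subgroup.closure_le _).mpr ?_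
      rintro _ ⟨a, ha, rfl⟩
      exact (QuotientGroup.eq_one_iff _).mp (hZp _ (hPM ha))
    · refine Subgroup.commutator_le.mpr fun a ha g _ => (QuotientGroup.eq_one_iff _).mp ?_
      have hc := Subgroup.mem_center_iff.mp (hZc (hPM ha)) (g : U ⧸ N)
      exact commutatorElement_eq_one_iff_mul_comm.mpr hc.symm

/-- Open normal subgroups of a profinite group separate points from `1`, and each contains some `P
k`. -/
theorem eq_one_of_forall_mem_lowerPSeries (hp : p.Prime) (hU : IsProP p U) {x : U}
    (hx : ∀ m, x ∈ P m) : x = 1 := by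
  have := hU.compactSpace
  have := hU.t2Space
  have := hU.totallyDisconnectedSpace
  by_contra h
  obtain ⟨N, hN⟩ := ProfiniteGrp.exist_openNormalSubgroup_sub_open_nhds_of_one
    (U := ({x}ᶜ : Set U)) isOpen_compl_singleton (fun h' => h h'.symm)
  obtain ⟨k, hk⟩ := hU.index_eq_pow N.toSubgroup N.isNormal' N.isOpen'
  exact hN (lowerPSeries_le_of_index_eq hp k _ N.isNormal' N.isOpen' hk (hx k)) rfl

end ProP

/-! ### Unique roots in uniform groups -/

section Uniform

variable {p : ℕ} {U : Type*} [Group U] [TopologicalSpace U] [IsTopologicalGroup U]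

local notation "P" => lowerPSeries p U

theorem IsUniform.index_lowerPSeries (hU : IsUniform p U) (i : ℕ) :
    (P i).index = (P 1).index ^ i := by
  induction i with
  | zero => simp [lowerPSeries]
  | succ i ih =>
    rw [← Subgroup.relIndex_mul_index (lowerPSeries_succ_le i), hU.relIndex_eq, ih, pow_succ']

theorem IsUniform.index_lowerPSeries_ne_zero (hp : p.Prime) (hU : IsUniform p U) (i : ℕ) :
    (P i).index ≠ 0 :=
  hU.index_lowerPSeries i ▸
    pow_ne_zero i (index_lowerPSeries_one_ne_zero hp.ne_zero hU.isTopologicallyFG)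

theorem IsUniform.isOpen_lowerPSeries (hp : p.Prime) (hU : IsUniform p U) (i : ℕ) :
    IsOpen (P i : Set U) :=
  have : (P i).FiniteIndex := ⟨hU.index_lowerPSeries_ne_zero hp i⟩
  Subgroup.isOpen_of_isClosed_of_finiteIndex _ (isClosed_lowerPSeries i)

/-- In a uniform group, `p`-th powers determine their roots: the map `x ↦ x ^ p` from `U ⧸ P m` to
`P 1 ⧸ P (m + 1)` is a surjection between finite sets of equal size. -/
theorem IsUniform.inv_mul_mem_of_pow_eq (hp : p.Prime) (hU : IsUniform p U) {x y : U}
    (h : x ^ p = y ^ p) (m : ℕ) : x⁻¹ * y ∈ P m := by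
  let Q := P 1 ⧸ (P (m + 1)).subgroupOf (P 1)
  have hmem : ∀ x : U, x ^ p ∈ P 1 := fun x =>
    pow_mem_lowerPSeries_succ (i := 0) (Subgroup.mem_top x)
  let f : U ⧸ P m → Q := Quotient.map' (fun x => ⟨x ^ p, hmem x⟩) fun x y hxy => by
    rw [QuotientGroup.leftRel_apply] at hxy ⊢
    exact inv_pow_mul_pow_mem hxy
  have hsurj : Function.Surjective f := by
    rintro ⟨z, hz⟩
    obtain ⟨x, hx⟩ := exists_pow_inv_mul_mem (hU.isOpen_lowerPSeries hp) hp hU.isPowerful m hz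
    exact ⟨x, QuotientGroup.eq.mpr hx⟩
  have hd := hU.index_lowerPSeries_ne_zero hp
  -- With `d` the index of `P 1`, both sides equal `d ^ m`: the index of `P (m + 1)` is `d ^ (m +
  -- 1)`, and passing to `P 1` divides it by `d`.
  have hcard : Nat.card (U ⧸ P m) = Nat.card Q := by
    have h1 := Subgroup.relIndex_mul_index
      (lowerPSeries_antitone (p := p) (U := U) (Nat.le_add_left 1 m))
    rw [hU.index_lowerPSeries (m + 1), pow_succ] at h1
    exact (hU.index_lowerPSeries m).trans
      (Nat.eq_of_mul_eq_mul_right (Nat.pos_of_ne_zero (hd 1)) h1).symm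
  have : Finite (U ⧸ P m) := Nat.finite_of_card_ne_zero (hd m)
  have hbij := hsurj.bijective_of_nat_card_le hcard.le
  have hxy : f (x : U ⧸ P m) = f (y : U ⧸ P m) :=
    congrArg (QuotientGroup.mk : P 1 → Q) (Subtype.ext h)
  exact QuotientGroup.eq.mp (hbij.injective hxy)

theorem IsUniform.inv_mul_mem_of_pow_eq_of_coprime (hp : p.Prime) (hU : IsUniform p U) {n : ℕ}
    (hn : p.Coprime n) {x y : U} (h : x ^ n = y ^ n) (m : ℕ) : x⁻¹ * y ∈ P m := by
  have hpg : IsPGroup p (U ⧸ P m) := isPGroup_quotient hU.isProP (hU.isOpen_lowerPSeries hp m)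
  exact QuotientGroup.eq.mp ((hpg.powEquiv hn).injective
    (congrArg (QuotientGroup.mk : U → U ⧸ P m) h))

theorem IsUniform.isMulTorsionFree (hp : p.Prime) (hU : IsUniform p U) : IsMulTorsionFree U where
  pow_left_injective n := by
    have key : ∀ q : ℕ, q.Prime → ∀ x y : U, x ^ q = y ^ q → x = y := by
      intro q hq x y h
      refine inv_mul_eq_one.mp (eq_one_of_forall_mem_lowerPSeries hp hU.isProP fun m => ?_)
      rcases eq_or_ne p q with rfl | hne
      · exact hU.inv_mul_mem_of_pow_eq hp h m
      · exact hU.inv_mul_mem_of_pow_eq_of_coprime hp ((Nat.coprime_primes hp hq).mpr hne) h m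
    induction n using induction_on_primes with
    | zero => exact fun h => absurd rfl h
    | one => exact fun _ x y h => by simpa using h
    | prime_mul q n hq ih =>
      intro hn x y h
      refine ih (right_ne_zero_of_mul hn) (key q hq _ _ ?_)
      simpa only [← pow_mul, mul_comm n q] using h

end Uniform

end ProPGroup

theorem theorem2p5 (p : ℕ) (hp : p.Prime) (U : Type*) [Group U] [TopologicalSpace U]
    [IsTopologicalGroup U] (hU : ProPGroup.IsUniform p U) (c : ℕ) (G : Subgroup U)
    (hG : ProPGroup.IsVirtuallyNilpotentOfClassLE c G) :
    ProPGroup.IsNilpotentOfClassLE c G :=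
  have := hU.isMulTorsionFree hp
  ProPGroup.isNilpotentOfClassLE_of_virtually c G hG
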